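/- **Theorem 4.5 (Adam vs. GD with convergence rates).** Let $d\in\mathbb N$, $\vartheta,\xi\in\mathbb R^d$, $\lambda_1,\dots,\lambda_d\in(0,\infty)$ satisfy $\min_i|\xi_i-\vartheta_i|>0$ and $$\kappa:=\min_i\lambda_i<\max_i\lambda_i=:\mathcal K ,$$ and let $\mathcal L(\theta)=\frac12\sum_{k=1}^d\lambda_k(\theta_k-\vartheta_k)^2$ for $\theta\in\mathbb R^d$. Let $\varepsilon\in(0,1)$, $\bar\gamma\in(0,\frac1{4\mathcal K})$, $\alpha=\bigl(\frac{1-\bar\gamma\kappa}{1+\bar\gamma\kappa}\bigr)^2$, $\beta\in(\alpha^2,1)$ and $\gamma\in[0,\bar\gamma]$. Let $\Phi\colon\mathbb N_0\to\mathbb R^d$ be gradient descent with step size $\gamma$ started at $\xi$, that is, $\Phi_0=\xi$ and $\Phi_n=\Phi_{n-1}-\gamma\,\nabla\mathcal L(\Phi_{n-1})$ for all $n\ge1$. Let $\Theta,m,M\colon\mathbb N_0\to\mathbb R^d$ follow the Adam recursion with step size $\varepsilon\bar\gamma$ started at $\xi$, that is, $\Theta_0=\xi$, $m_0\in\mathbb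 R^d$ is arbitrary, $M_0\in[0,\infty)^d$, and for all $n\ge1$ (with all operations on vectors understood componentwise) $$m_n=\alpha m_{n-1}+(1-\alpha)\nabla\mathcal L(\Theta_{n-1}),\qquad M_n=\beta M_{n-1}+(1-\beta)\bigl[\nabla\mathcal L(\Theta_{n-1})\bigr]^2,$$ $$\Theta_n=\Theta_{n-1}-\frac{\varepsilon\bar\gamma}{1-\alpha^n}\,\Bigl(\varepsilon+(1-\beta^n)^{-1/2}M_n^{1/2}\Bigr)^{-1}m_n .$$ Then for every $\delta\in(0,1-\bar\gamma\kappa)$, with $\|\cdot\|$ the Euclidean norm, $$\lim_{n\to\infty}(1-\bar\gamma\kappa-\delta)^{-n}\,\|\Phi_n-\vartheta\|=\infty\qquad\text{and}\qquad\lim_{n\to\infty}\Bigl(\frac{1-\bar\gamma\kappa}{1+\bar\gamma\kappa}+\delta\Bigr)^{-n}\|\Theta_n-\vartheta\|=0 .$$ Hence Adam is strictly faster than gradient descent in this regime: $\|\Theta_n-\vartheta\|=o(\|\Phi_n-\vartheta\|)$ as $n\to\infty$. -/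

import Mathlib

/-- `Φ` is the trajectory of gradient descent for the objective `L` with learning rate `γ`,
started at `ξ`. -/
structure IsGDTrajectory {d : ℕ} (L : EuclideanSpace ℝ (Fin d) → ℝ) (γ : ℝ)
    (ξ : EuclideanSpace ℝ (Fin d)) (Φ : ℕ → EuclideanSpace ℝ (Fin d)) : Prop where
  init : Φ 0 = ξ
  step : ∀ n : ℕ, Φ (n + 1) = Φ n - γ • gradient L (Φ n)

/-- `Θ` is a trajectory of the (bias-corrected) Adam optimizer for the objective `L` with first
and second moment parameters `α`, `β`, learning rate `γ` and regularization parameter `ε`, started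
at `ξ`; `m` and `M` are the first and second moment accumulators. All operations on vectors are
componentwise. The accumulators may start at any `m 0` and at any `M 0` with nonnegative
components. -/
structure IsAdamTrajectory {d : ℕ} (L : EuclideanSpace ℝ (Fin d) → ℝ) (α β γ ε : ℝ)
    (ξ : EuclideanSpace ℝ (Fin d)) (Θ m M : ℕ → EuclideanSpace ℝ (Fin d)) : Prop where
  init : Θ 0 = ξ
  init_nonneg : ∀ i : Fin d, 0 ≤ M 0 i
  step_m : ∀ (n : ℕ) (i : Fin d),
    m (n + 1) i = α * m n i + (1 - α) * gradient L (Θ n) i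
  step_M : ∀ (n : ℕ) (i : Fin d),
    M (n + 1) i = β * M n i + (1 - β) * (gradient L (Θ n) i) ^ 2
  step : ∀ (n : ℕ) (i : Fin d),
    Θ (n + 1) i = Θ n i - γ * (1 - α ^ (n + 1))⁻¹ *
      (ε + (1 - β ^ (n + 1)) ^ (-(1 / 2 : ℝ)) * (M (n + 1) i) ^ (1 / 2 : ℝ))⁻¹ * m (n + 1) i

open Filter Topology Asymptotics

/-! On a diagonal quadratic both methods act coordinatewise. Gradient descent multiplies the error
along the smallest eigenvalue `κ` by `1 - γ * κ ≥ 1 - γbar * κ` at each step, which bounds its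
speed. A coordinate of Adam is a momentum method with varying step size. Since `α ^ 2 < β`, this
step size eventually grows by at most `1 / α` per step, so an energy decreases
(`momentum_energy_step`). The error is then bounded, hence the steps stay away from zero, hence the
error tends to zero (`momentum_tendsto_zero`). So the second moment vanishes and the step size tends
to `ε * γbar / ε = γbar`. Eliminating `m` leaves a second order recursion whose limiting
characteristic roots all have modulus `ρ = √α` (`momentum_discriminant_nonpos`), so the error is
`O((ρ + τ) ^ n)` for every `τ > 0` (`isBigO_pow_of_perturbed_recursion`). Finally `ρ < 1 - γbar *
κ`. -/

/-! ### Linear recursions with converging coefficients -/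

theorem isBigO_pow_of_eventually_le_mul {W : ℕ → ℝ} {q : ℝ} (hW : ∀ n, 0 ≤ W n) (hq : 0 < q)
    (h : ∀ᶠ n in atTop, W (n + 1) ≤ q * W n) : W =O[atTop] fun n : ℕ => q ^ n := by
  obtain ⟨N, hN⟩ := eventually_atTop.1 h
  refine IsBigO.of_bound (W N / q ^ N) (eventually_atTop.2 ⟨N, fun n hn => ?_⟩)
  rw [Real.norm_of_nonneg (hW n), Real.norm_of_nonneg (by positivity)]
  induction n, hn using Nat.le_induction with
  | base => rw [div_mul_cancel₀ _ (by positivity)]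
  | succ n hn ih =>
    calc W (n + 1) ≤ q * W n := hN n hn
      _ ≤ q * (W N / q ^ N * q ^ n) := by gcongr
      _ = W N / q ^ N * q ^ (n + 1) := by ring

/-- Nonpositive discriminant makes the roots of `z ^ 2 - p * z + ρ ^ 2` conjugate, so both have
modulus `ρ`. -/
theorem exists_conj_root {p ρ : ℝ} (hρ : 0 ≤ ρ) (hp : p ^ 2 ≤ 4 * ρ ^ 2) :
    ∃ r s : ℂ, r + s = p ∧ r * s = (ρ : ℂ) ^ 2 ∧ ‖r‖ = ρ ∧ ‖s‖ = ρ := by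
  set t := √(ρ ^ 2 - (p / 2) ^ 2)
  have ht : t * t = ρ ^ 2 - (p / 2) ^ 2 := Real.mul_self_sqrt (by nlinarith)
  have hn : ∀ y : ℝ, y * y = t * t → ‖(⟨p / 2, y⟩ : ℂ)‖ = ρ := fun y hy => by
    rw [Complex.norm_def, Complex.normSq_mk, hy, ht, ← Real.sqrt_sq hρ]
    congr 1
    rw [Real.sqrt_sq hρ]; ring
  refine ⟨⟨p / 2, t⟩, ⟨p / 2, -t⟩, ?_, ?_, hn _ rfl, hn _ (by ring)⟩
  · apply Complex.ext <;> simp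
  · rw [← Complex.ofReal_pow]
    apply Complex.ext
    · simp only [Complex.mul_re, Complex.ofReal_re]; linarith
    · simp only [Complex.mul_im, Complex.ofReal_im]; ring

/-- A second order linear recursion whose coefficients converge, with limiting characteristic
polynomial having both roots of modulus `ρ`, has solutions of growth at most `(ρ + τ) ^ n`. -/
theorem isBigO_pow_of_perturbed_recursion {x a b : ℕ → ℝ} {p ρ τ : ℝ} (hρ : 0 ≤ ρ)
    (hp : p ^ 2 ≤ 4 * ρ ^ 2) (ha : Tendsto a atTop (𝓝 0)) (hb : Tendsto b atTop (𝓝 0))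
    (hx : ∀ n, x (n + 2) = (p + a n) * x (n + 1) - (ρ ^ 2 + b n) * x n) (hτ : 0 < τ) :
    x =O[atTop] fun n : ℕ => (ρ + τ) ^ n := by
  obtain ⟨r, s, hrs, hrs', hr, hs⟩ := exists_conj_root hρ hp
  set σ := τ / 2 with hσ
  have hσ0 : 0 < σ := by positivity
  -- Factoring out the root `r` makes the system triangular. The small weight `σ` on `x` in `W`
  -- makes the coupling cost `σ * W`; the perturbation costs another, and `2 * σ = τ`.
  set v : ℕ → ℂ := fun n => x (n + 1) - r * x n with hv
  set W : ℕ → ℝ := fun n => σ * |x n| + ‖v n‖ with hWdef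
  have hW : ∀ n, 0 ≤ W n := fun n => by positivity
  have hvs : ∀ n, v (n + 1) = s * v n + ((a n * x (n + 1) - b n * x n : ℝ) : ℂ) := fun n => by
    simp only [hv, hx n]
    push_cast
    linear_combination ((x (n + 1) : ℝ) : ℂ) * (-hrs) + hrs' * ((x n : ℝ) : ℂ)
  have hx1 : ∀ n, |x (n + 1)| ≤ ρ * |x n| + ‖v n‖ := fun n => by
    have : ((x (n + 1) : ℝ) : ℂ) = r * x n + v n := by simp [hv]
    calc |x (n + 1)| = ‖r * x n + v n‖ := by rw [← this, Complex.norm_real, Real.norm_eq_abs]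
      _ ≤ ‖r * x n‖ + ‖v n‖ := norm_add_le _ _
      _ = _ := by rw [norm_mul, hr, Complex.norm_real, Real.norm_eq_abs]
  have hv1 : ∀ n, ‖v (n + 1)‖ ≤ ρ * ‖v n‖ + (|a n| * |x (n + 1)| + |b n| * |x n|) := fun n => by
    rw [hvs]
    refine (norm_add_le _ _).trans ?_
    rw [norm_mul, hs, Complex.norm_real, Real.norm_eq_abs, ← abs_mul, ← abs_mul]
    gcongr
    exact abs_sub _ _
  have hlim : Tendsto (fun n => |a n| * (ρ / σ + 1) + |b n| / σ) atTop (𝓝 0) := by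
    have h := (ha.abs.mul_const (ρ / σ + 1)).add (hb.abs.div_const σ)
    simpa using h
  have hstep : ∀ᶠ n in atTop, W (n + 1) ≤ (ρ + τ) * W n := by
    filter_upwards [hlim.eventually_le_const hσ0] with n hn
    have hxW : |x n| ≤ W n / σ := by
      rw [le_div_iff₀ hσ0]; simp only [hWdef]; nlinarith [norm_nonneg (v n)]
    have hvW : ‖v n‖ ≤ W n := by simp only [hWdef]; nlinarith [abs_nonneg (x n)]
    have hx1W : |x (n + 1)| ≤ (ρ / σ + 1) * W n :=
      calc |x (n + 1)| ≤ ρ * (W n / σ) + W n := (hx1 n).trans (by gcongr)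
        _ = _ := by ring
    have herr : |a n| * |x (n + 1)| + |b n| * |x n| ≤ σ * W n :=
      calc |a n| * |x (n + 1)| + |b n| * |x n|
          ≤ |a n| * ((ρ / σ + 1) * W n) + |b n| * (W n / σ) := by gcongr
        _ = (|a n| * (ρ / σ + 1) + |b n| / σ) * W n := by ring
        _ ≤ σ * W n := by gcongr
    have h1 : σ * |x (n + 1)| ≤ σ * (ρ * |x n| + ‖v n‖) := by gcongr; exact hx1 n
    have h2 : σ * ‖v n‖ ≤ σ * W n := by gcongr
    calc W (n + 1) ≤ σ * (ρ * |x n| + ‖v n‖) + (ρ * ‖v n‖ + σ * W n) :=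
          add_le_add h1 ((hv1 n).trans (by gcongr))
      _ = ρ * W n + σ * W n + σ * ‖v n‖ := by simp only [hWdef]; ring
      _ ≤ (ρ + τ) * W n := by rw [hσ] at h2 ⊢; linarith
  refine IsBigO.trans ?_ (isBigO_pow_of_eventually_le_mul hW (by positivity) hstep)
  refine IsBigO.of_bound σ⁻¹ (Eventually.of_forall fun n => ?_)
  rw [Real.norm_of_nonneg (hW n), Real.norm_eq_abs, inv_mul_eq_div, le_div_iff₀ hσ0]
  simp only [hWdef]; nlinarith [norm_nonneg (v n)]

theorem tendsto_zero_of_le_mul_add {u w : ℕ → ℝ} {q : ℝ} (hu : ∀ n, 0 ≤ u n) (hq : 0 < q)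
    (hq1 : q < 1) (hw : Tendsto w atTop (𝓝 0)) (h : ∀ n, u (n + 1) ≤ q * u n + w n) :
    Tendsto u atTop (𝓝 0) := by
  rw [Metric.tendsto_atTop']
  intro δ hδ
  -- The threshold makes `δ / 2` the fixed point of the affine bound.
  obtain ⟨N, hN⟩ := eventually_atTop.1
    (hw.eventually_le_const (show 0 < (1 - q) * (δ / 2) by nlinarith))
  have hle : ∀ k, u (N + k) ≤ q ^ k * u N + δ / 2 := fun k => by
    induction k with
    | zero => simp; positivity
    | succ k ih =>
      calc u (N + (k + 1)) ≤ q * u (N + k) + w (N + k) := h _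
        _ ≤ q * (q ^ k * u N + δ / 2) + (1 - q) * (δ / 2) := by gcongr; exact hN _ (by omega)
        _ = _ := by ring
  have hlim : Tendsto (fun k => q ^ k * u N) atTop (𝓝 0) := by
    simpa using (tendsto_pow_atTop_nhds_zero_of_lt_one hq.le hq1).mul_const (u N)
  obtain ⟨k₀, hk₀⟩ := eventually_atTop.1 (hlim.eventually_lt_const (half_pos hδ))
  refine ⟨N + k₀, fun n hn => ?_⟩
  obtain ⟨k, rfl⟩ := Nat.exists_eq_add_of_le (show N ≤ n by omega)
  rw [Real.dist_0_eq_abs, abs_of_nonneg (hu _)]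
  linarith [hle k, hk₀ k (by omega)]

theorem bddAbove_of_le_mul_add {u : ℕ → ℝ} {q B : ℝ} (hq : 0 ≤ q) (hq1 : q < 1)
    (h : ∀ n, u (n + 1) ≤ q * u n + (1 - q) * B) (n : ℕ) : u n ≤ max (u 0) B := by
  induction n with
  | zero => exact le_max_left _ _
  | succ n ih => nlinarith [h n, le_max_right (u 0) B]

/-! ### Energy decay for momentum with variable steps -/

/-- One step of the momentum method with step size `η` on `x ↦ lam * x ^ 2 / 2`, followed by a
step size `η'` with `α * η' ≤ η`, decreases the energy. -/
theorem momentum_energy_step {α lam x m η η' m' x' : ℝ} (hα : α ∈ Set.Ioo (0 : ℝ) 1)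
    (hη : 0 < η) (hη' : α * η' ≤ η) (hlη : lam * η ≤ 1 / 2)
    (hm : m' = α * m + (1 - α) * (lam * x)) (hx : x' = x - η * m') :
    lam * x' ^ 2 / 2 + α / (2 * (1 - α)) * η' * m' ^ 2 + η / 4 * m' ^ 2 ≤
      lam * x ^ 2 / 2 + α / (2 * (1 - α)) * η * m ^ 2 := by
  have h1 : 0 < 1 - α := sub_pos.2 hα.2
  -- With the gradient written through `m` and `m'`, the remaining slack is a multiple of `(m' - m)
  -- ^ 2`.
  have hlx : lam * x = (m' - α * m) / (1 - α) := by rw [hm]; field_simp; ring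
  have e : lam * x' ^ 2 / 2 = lam * x ^ 2 / 2 - η * m' * ((m' - α * m) / (1 - α))
      + (lam * η) * (η * m' ^ 2) / 2 := by
    rw [← hlx, hx]; ring
  have h2 : (lam * η) * (η * m' ^ 2) ≤ 1 / 2 * (η * m' ^ 2) := by gcongr
  have h3 : α / (2 * (1 - α)) * η' * m' ^ 2 ≤ η / (2 * (1 - α)) * m' ^ 2 := by
    gcongr
    rw [div_mul_eq_mul_div]
    gcongr
  have h4 : 0 ≤ α / (2 * (1 - α)) * η * (m' - m) ^ 2 := by
    have := hα.1
    positivity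
  have h5 : lam * x ^ 2 / 2 + α / (2 * (1 - α)) * η * m ^ 2 -
      (lam * x ^ 2 / 2 - η * m' * ((m' - α * m) / (1 - α)) + 1 / 2 * (η * m' ^ 2) / 2
        + η / (2 * (1 - α)) * m' ^ 2 + η / 4 * m' ^ 2) =
      α / (2 * (1 - α)) * η * (m' - m) ^ 2 := by
    field_simp; ring
  linarith

section Momentum

variable {α lam : ℝ} {x m η : ℕ → ℝ}

/-- Energy of the momentum method with variable step sizes. -/
noncomputable def momentumEnergy (α lam : ℝ) (x m η : ℕ → ℝ) (n : ℕ) : ℝ :=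
  lam * x n ^ 2 / 2 + α / (2 * (1 - α)) * η n * m n ^ 2

theorem momentumEnergy_eventually_le (hα : α ∈ Set.Ioo (0 : ℝ) 1) (hη : ∀ n, 0 < η n)
    (hη' : ∀ᶠ n in atTop, α * η (n + 1) ≤ η n) (hlη : ∀ᶠ n in atTop, lam * η n ≤ 1 / 2)
    (hm : ∀ n, m (n + 1) = α * m n + (1 - α) * (lam * x n))
    (hx : ∀ n, x (n + 1) = x n - η n * m (n + 1)) :
    ∀ᶠ n in atTop, momentumEnergy α lam x m η (n + 1) + η n / 4 * m (n + 1) ^ 2 ≤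
      momentumEnergy α lam x m η n := by
  filter_upwards [hη', hlη] with n h1 h2
  exact momentum_energy_step hα (hη n) h1 h2 (hm n) (hx n)

theorem sq_le_of_momentumEnergy (hα : α ∈ Set.Ioo (0 : ℝ) 1) (hη : ∀ n, 0 < η n) (n : ℕ) :
    lam * x n ^ 2 / 2 ≤ momentumEnergy α lam x m η n := by
  have h1 : 0 < 1 - α := sub_pos.2 hα.2
  have := hα.1
  have := hη n
  exact le_add_of_nonneg_right (by positivity)

/-- Steps are only assumed positive: for Adam, their uniform lower bound is deduced from this
boundedness. -/
theorem momentum_bounded (hα : α ∈ Set.Ioo (0 : ℝ) 1) (hlam : 0 < lam) (hη : ∀ n, 0 < η n)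
    (hη' : ∀ᶠ n in atTop, α * η (n + 1) ≤ η n) (hlη : ∀ᶠ n in atTop, lam * η n ≤ 1 / 2)
    (hm : ∀ n, m (n + 1) = α * m n + (1 - α) * (lam * x n))
    (hx : ∀ n, x (n + 1) = x n - η n * m (n + 1)) :
    ∃ B, ∀ n, x n ^ 2 ≤ B := by
  obtain ⟨N, hN⟩ := eventually_atTop.1 (momentumEnergy_eventually_le hα hη hη' hlη hm hx)
  have hle : ∀ n ≥ N, momentumEnergy α lam x m η n ≤ momentumEnergy α lam x m η N := by
    intro n hn
    induction n, hn using Nat.le_induction with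
    | base => rfl
    | succ n hn ih =>
      have h1 := hN n hn
      have := hη n
      have : 0 ≤ η n / 4 * m (n + 1) ^ 2 := by positivity
      linarith
  have hb : BddAbove (Set.range fun n => x n ^ 2) := by
    refine Filter.IsBoundedUnder.bddAbove_range
      ⟨2 * momentumEnergy α lam x m η N / lam, eventually_map.2 (eventually_atTop.2 ⟨N, fun n hn => ?_⟩)⟩
    refine (le_div_iff₀ hlam).2 ?_
    have h1 := hle n hn
    have h2 := sq_le_of_momentumEnergy (lam := lam) (x := x) (m := m) hα hη n
    linarith
  obtain ⟨B, hB⟩ := hb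
  exact ⟨B, fun n => hB ⟨n, rfl⟩⟩

/-- The energy converges, so its decrements, which dominate `c / 4 * m (n + 1) ^ 2`, vanish; the
recursion for `m` then recovers `x`. -/
theorem momentum_tendsto_zero (hα : α ∈ Set.Ioo (0 : ℝ) 1) (hlam : 0 < lam) {c : ℝ} (hc : 0 < c)
    (hη : ∀ n, c ≤ η n)
    (hη' : ∀ᶠ n in atTop, α * η (n + 1) ≤ η n) (hlη : ∀ᶠ n in atTop, lam * η n ≤ 1 / 2)
    (hm : ∀ n, m (n + 1) = α * m n + (1 - α) * (lam * x n))
    (hx : ∀ n, x (n + 1) = x n - η n * m (n + 1)) :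
    Tendsto x atTop (𝓝 0) := by
  have hη0 : ∀ n, 0 < η n := fun n => hc.trans_le (hη n)
  obtain ⟨N, hN⟩ := eventually_atTop.1 (momentumEnergy_eventually_le hα hη0 hη' hlη hm hx)
  set V := momentumEnergy α lam x m η
  have hanti : Antitone fun k => V (k + N) := antitone_nat_of_succ_le fun k => by
    have h1 := hN (k + N) (by omega)
    have := hη0 (k + N)
    have : 0 ≤ η (k + N) / 4 * m (k + N + 1) ^ 2 := by positivity
    have e : k + 1 + N = k + N + 1 := by ring
    rw [e]; linarith
  have hbdd : BddBelow (Set.range fun k => V (k + N)) := ⟨0, by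
    rintro _ ⟨k, rfl⟩
    exact le_trans (by positivity) (sq_le_of_momentumEnergy hα hη0 (k + N))⟩
  have hV := (tendsto_add_atTop_iff_nat N).1 (tendsto_atTop_ciInf hanti hbdd)
  have hdiff := (hV.sub ((tendsto_add_atTop_iff_nat 1).2 hV)).const_mul (4 / c)
  rw [sub_self, mul_zero] at hdiff
  have hmsq : Tendsto (fun n => m (n + 1) ^ 2) atTop (𝓝 0) := by
    refine squeeze_zero' (Eventually.of_forall fun n => sq_nonneg _)
      (eventually_atTop.2 ⟨N, fun n hn => ?_⟩) hdiff
    have h1 := hN n hn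
    have h2 : c * m (n + 1) ^ 2 ≤ η n * m (n + 1) ^ 2 := by gcongr; exact hη n
    rw [div_mul_eq_mul_div, le_div_iff₀ hc]
    linarith
  have hm1 : Tendsto (fun n => m (n + 1)) atTop (𝓝 0) := by
    rw [tendsto_zero_iff_abs_tendsto_zero]
    simpa [Function.comp_def, Real.sqrt_sq_eq_abs] using hmsq.sqrt
  have hm0 := (tendsto_add_atTop_iff_nat 1).1 hm1
  have h1 : 1 - α ≠ 0 := (sub_pos.2 hα.2).ne'
  have hxe : x = fun n => (m (n + 1) - α * m n) / ((1 - α) * lam) := by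
    funext n; rw [hm]; field_simp; ring
  rw [hxe]
  simpa using (hm1.sub (hm0.const_mul α)).div_const ((1 - α) * lam)

end Momentum

/-! ### Adam's effective step size in one coordinate -/

section Adam

variable {α β γ ε lam : ℝ} {x m M : ℕ → ℝ}

/-- The step size that bias-corrected Adam effectively applies to one coordinate. -/
noncomputable def adamStep (α β γ ε : ℝ) (M : ℕ → ℝ) (n : ℕ) : ℝ :=
  ε * γ * (1 - α ^ (n + 1))⁻¹ * (ε + √(M (n + 1) / (1 - β ^ (n + 1))))⁻¹

theorem sqrt_div_eq_rpow_mul_rpow {a b : ℝ} (ha : 0 ≤ a) (hb : 0 < b) :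
    √(a / b) = b ^ (-(1 / 2 : ℝ)) * a ^ (1 / 2 : ℝ) := by
  rw [Real.sqrt_div ha, Real.rpow_neg hb.le, ← Real.sqrt_eq_rpow, ← Real.sqrt_eq_rpow]
  ring

theorem one_sub_pow_succ_pos {q : ℝ} (hq : q ∈ Set.Ioo (0 : ℝ) 1) (n : ℕ) :
    0 < 1 - q ^ (n + 1) :=
  sub_pos.2 (pow_lt_one₀ hq.1.le hq.2 n.succ_ne_zero)

theorem tendsto_one_sub_pow_succ {q : ℝ} (hq : q ∈ Set.Ioo (0 : ℝ) 1) :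
    Tendsto (fun n : ℕ => 1 - q ^ (n + 1)) atTop (𝓝 1) := by
  have h := (tendsto_add_atTop_iff_nat 1).2
    (tendsto_pow_atTop_nhds_zero_of_lt_one hq.1.le hq.2)
  simpa using h.const_sub 1

theorem secondMoment_nonneg (hβ : β ∈ Set.Ioo (0 : ℝ) 1) (hM0 : 0 ≤ M 0)
    (hM : ∀ n, M (n + 1) = β * M n + (1 - β) * (lam * x n) ^ 2) (n : ℕ) : 0 ≤ M n := by
  induction n with
  | zero => exact hM0
  | succ n ih =>
    have := hβ.1
    have : 0 < 1 - β := sub_pos.2 hβ.2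
    rw [hM]; positivity

theorem adamStep_pos (hα : α ∈ Set.Ioo (0 : ℝ) 1) (hγ : 0 < γ) (hε : 0 < ε) (n : ℕ) :
    0 < adamStep α β γ ε M n := by
  have := one_sub_pow_succ_pos hα n
  unfold adamStep
  positivity

theorem adamStep_le (hα : α ∈ Set.Ioo (0 : ℝ) 1) (hγ : 0 < γ) (hε : 0 < ε) (n : ℕ) :
    adamStep α β γ ε M n ≤ γ * (1 - α ^ (n + 1))⁻¹ := by
  have := one_sub_pow_succ_pos hα n
  calc adamStep α β γ ε M n ≤ ε * γ * (1 - α ^ (n + 1))⁻¹ * ε⁻¹ := by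
        unfold adamStep
        gcongr
        exact le_add_of_nonneg_right (Real.sqrt_nonneg _)
    _ = _ := by field_simp

theorem eventually_mul_adamStep_le (hα : α ∈ Set.Ioo (0 : ℝ) 1) (hγ : 0 < γ) (hε : 0 < ε)
    (hlam : 0 < lam) (hlγ : lam * γ < 1 / 2) :
    ∀ᶠ n in atTop, lam * adamStep α β γ ε M n ≤ 1 / 2 := by
  have h : Tendsto (fun n : ℕ => lam * (γ * (1 - α ^ (n + 1))⁻¹)) atTop (𝓝 (lam * γ)) := by
    simpa using (((tendsto_one_sub_pow_succ hα).inv₀ one_ne_zero).const_mul γ).const_mul lam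
  filter_upwards [h.eventually_le_const hlγ] with n hn
  exact (mul_le_mul_of_nonneg_left (adamStep_le hα hγ hε n) hlam.le).trans hn

/-- The second moment shrinks at most by the factor `β > α ^ 2`, so its root shrinks by no more than
`α`; strictness absorbs the bias correction for large `n`. -/
theorem eventually_mul_adamStep_succ_le (hα : α ∈ Set.Ioo (0 : ℝ) 1)
    (hβ : β ∈ Set.Ioo (0 : ℝ) 1) (hαβ : α ^ 2 < β) (hγ : 0 < γ) (hε : 0 < ε) (hM0 : 0 ≤ M 0)
    (hM : ∀ n, M (n + 1) = β * M n + (1 - β) * (lam * x n) ^ 2) :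
    ∀ᶠ n in atTop, α * adamStep α β γ ε M (n + 1) ≤ adamStep α β γ ε M n := by
  have h : Tendsto (fun n : ℕ => β * (1 - β ^ (n + 1))) atTop (𝓝 β) := by
    simpa using (tendsto_one_sub_pow_succ hβ).const_mul β
  filter_upwards [h.eventually_const_le hαβ] with n hn
  have hα0 := hα.1
  have hβ0 := hβ.1
  have hMn := secondMoment_nonneg hβ hM0 hM (n + 1)
  have ha := one_sub_pow_succ_pos hα n
  have ha' := one_sub_pow_succ_pos hα (n + 1)
  have hb := one_sub_pow_succ_pos hβ n
  have hb' := one_sub_pow_succ_pos hβ (n + 1)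
  have hs : α * √(M (n + 1) / (1 - β ^ (n + 1))) ≤ √(M (n + 1 + 1) / (1 - β ^ (n + 1 + 1))) := by
    rw [← Real.sqrt_sq hα0.le, ← Real.sqrt_mul (sq_nonneg α)]
    refine Real.sqrt_le_sqrt ?_
    rw [mul_div_assoc', div_le_div_iff₀ hb hb']
    have h1 : β * M (n + 1) ≤ M (n + 1 + 1) := by
      rw [hM (n + 1)]
      exact le_add_of_nonneg_right (mul_nonneg (sub_nonneg.2 hβ.2.le) (sq_nonneg _))
    have h2 : 1 - β ^ (n + 1 + 1) ≤ 1 := by linarith [pow_pos hβ0 (n + 1 + 1)]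
    calc α ^ 2 * M (n + 1) * (1 - β ^ (n + 1 + 1)) ≤ α ^ 2 * M (n + 1) * 1 := by gcongr
      _ ≤ β * (1 - β ^ (n + 1)) * M (n + 1) := by rw [mul_one]; gcongr
      _ = β * M (n + 1) * (1 - β ^ (n + 1)) := by ring
      _ ≤ _ := by gcongr
  have hden : α * (ε + √(M (n + 1) / (1 - β ^ (n + 1)))) ≤
      ε + √(M (n + 1 + 1) / (1 - β ^ (n + 1 + 1))) := by
    nlinarith [hα.2]
  have hbias : (1 - α ^ (n + 1 + 1))⁻¹ ≤ (1 - α ^ (n + 1))⁻¹ := by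
    refine inv_anti₀ ha (sub_le_sub_left ?_ 1)
    exact pow_le_pow_of_le_one hα0.le hα.2.le (Nat.le_succ _)
  have hinv : α * (ε + √(M (n + 1 + 1) / (1 - β ^ (n + 1 + 1))))⁻¹ ≤
      (ε + √(M (n + 1) / (1 - β ^ (n + 1))))⁻¹ := by
    rw [← div_eq_mul_inv, div_le_iff₀ (by positivity), inv_mul_eq_div, le_div_iff₀ (by positivity)]
    exact hden
  calc α * adamStep α β γ ε M (n + 1)
      = ε * γ * (1 - α ^ (n + 1 + 1))⁻¹ *
        (α * (ε + √(M (n + 1 + 1) / (1 - β ^ (n + 1 + 1))))⁻¹) := by unfold adamStep; ring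
    _ ≤ _ := by unfold adamStep; gcongr

theorem exists_forall_le_adamStep (hα : α ∈ Set.Ioo (0 : ℝ) 1)
    (hβ : β ∈ Set.Ioo (0 : ℝ) 1) (hγ : 0 < γ) (hε : 0 < ε)
    (hM0 : 0 ≤ M 0) (hM : ∀ n, M (n + 1) = β * M n + (1 - β) * (lam * x n) ^ 2)
    {B : ℝ} (hB : ∀ n, x n ^ 2 ≤ B) : ∃ c > 0, ∀ n, c ≤ adamStep α β γ ε M n := by
  have h1β : 0 < 1 - β := sub_pos.2 hβ.2
  have hMB := bddAbove_of_le_mul_add (u := M) (B := lam ^ 2 * B) hβ.1.le hβ.2 fun n => by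
    rw [hM, mul_pow]
    gcongr
    exact hB n
  refine ⟨ε * γ * 1 * (ε + √(max (M 0) (lam ^ 2 * B) / (1 - β)))⁻¹, by positivity, fun n => ?_⟩
  have ha := one_sub_pow_succ_pos hα n
  have h1 : (1 : ℝ) ≤ (1 - α ^ (n + 1))⁻¹ :=
    (one_le_inv₀ ha).2 (by linarith [pow_pos hα.1 (n + 1)])
  have h2 : 1 - β ≤ 1 - β ^ (n + 1) :=
    sub_le_sub_left (pow_le_of_le_one hβ.1.le hβ.2.le n.succ_ne_zero) 1
  unfold adamStep
  gcongr
  exact hMB (n + 1)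

theorem adamStep_tendsto (hα : α ∈ Set.Ioo (0 : ℝ) 1) (hβ : β ∈ Set.Ioo (0 : ℝ) 1)
    (hε : 0 < ε) (hM : Tendsto M atTop (𝓝 0)) :
    Tendsto (adamStep α β γ ε M) atTop (𝓝 γ) := by
  have h1 := (((tendsto_add_atTop_iff_nat 1).2 hM).div (tendsto_one_sub_pow_succ hβ)
    one_ne_zero).sqrt.const_add ε
  have h2 := (((tendsto_one_sub_pow_succ hα).inv₀ one_ne_zero).const_mul (ε * γ)).mul
    (h1.inv₀ (by simpa using hε.ne'))
  have e : ε * γ * 1⁻¹ * (ε + √(0 / 1))⁻¹ = γ := by simp; field_simp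
  rw [e] at h2
  exact h2

theorem secondMoment_tendsto_zero (hβ : β ∈ Set.Ioo (0 : ℝ) 1) (hM0 : 0 ≤ M 0)
    (hM : ∀ n, M (n + 1) = β * M n + (1 - β) * (lam * x n) ^ 2)
    (hx : Tendsto x atTop (𝓝 0)) : Tendsto M atTop (𝓝 0) := by
  refine tendsto_zero_of_le_mul_add (secondMoment_nonneg hβ hM0 hM) hβ.1 hβ.2 ?_
    fun n => (hM n).le
  simpa using ((hx.const_mul lam).pow 2).const_mul (1 - β)

/-- One coordinate of Adam on a quadratic objective: the error has the asymptotic rate of the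
momentum method obtained by freezing the adaptive step size at its limit `γ`. -/
theorem adam_coordinate_isBigO {ρ : ℝ} (hρ : ρ ∈ Set.Ioo (0 : ℝ) 1) (hα : α = ρ ^ 2)
    (hβ : β ∈ Set.Ioo (α ^ 2) 1) (hγ : 0 < γ) (hε : 0 < ε) (hlam : 0 < lam)
    (hlγ : lam * γ < 1 / 2) (hp : (1 + α - (1 - α) * lam * γ) ^ 2 ≤ 4 * ρ ^ 2) (hM0 : 0 ≤ M 0)
    (hm : ∀ n, m (n + 1) = α * m n + (1 - α) * (lam * x n))
    (hM : ∀ n, M (n + 1) = β * M n + (1 - β) * (lam * x n) ^ 2)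
    (hx : ∀ n, x (n + 1) = x n - adamStep α β γ ε M n * m (n + 1)) {τ : ℝ} (hτ : 0 < τ) :
    x =O[atTop] fun n : ℕ => (ρ + τ) ^ n := by
  have hα' : α ∈ Set.Ioo (0 : ℝ) 1 :=
    ⟨hα ▸ pow_pos hρ.1 2, hα ▸ pow_lt_one₀ hρ.1.le hρ.2 two_ne_zero⟩
  have hβ' : β ∈ Set.Ioo (0 : ℝ) 1 := ⟨(sq_nonneg α).trans_lt hβ.1, hβ.2⟩
  have hpos : ∀ n, 0 < adamStep α β γ ε M n := adamStep_pos hα' hγ hε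
  have hratio := eventually_mul_adamStep_succ_le hα' hβ' hβ.1 hγ hε hM0 hM
  have hsmall := eventually_mul_adamStep_le (β := β) (M := M) hα' hγ hε hlam hlγ
  obtain ⟨B, hB⟩ := momentum_bounded hα' hlam hpos hratio hsmall hm hx
  obtain ⟨c, hc, hcη⟩ := exists_forall_le_adamStep hα' hβ' hγ hε hM0 hM hB
  have hx0 := momentum_tendsto_zero hα' hlam hc hcη hratio hsmall hm hx
  have hη := adamStep_tendsto (γ := γ) hα' hβ' hε (secondMoment_tendsto_zero hβ' hM0 hM hx0)
  set η := adamStep α β γ ε M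
  have hη1 := (tendsto_add_atTop_iff_nat 1).2 hη
  have hb : Tendsto (fun n => α * (η (n + 1) / η n - 1)) atTop (𝓝 0) := by
    simpa [hγ.ne'] using ((hη1.div hη hγ.ne').sub_const 1).const_mul α
  have ha : Tendsto (fun n => α * (η (n + 1) / η n - 1) - (1 - α) * lam * (η (n + 1) - γ))
      atTop (𝓝 0) := by
    simpa using hb.sub ((hη1.sub_const γ).const_mul ((1 - α) * lam))
  refine isBigO_pow_of_perturbed_recursion hρ.1.le hp ha hb (fun n => ?_) hτ
  have h0 := (hpos n).ne'
  -- Eliminating the momentum produces the ratio `η (n + 1) / η n`, which tends to `1`.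
  have hmn : m (n + 1) = (x n - x (n + 1)) / η n := by rw [hx n]; field_simp; ring
  rw [hx (n + 1), hm (n + 1), hmn, ← hα]
  field_simp
  ring

end Adam

/-! ### Reduction of the quadratic objective to coordinates -/

section Quadratic

variable {d : ℕ} {ϑ : EuclideanSpace ℝ (Fin d)} {lam : Fin d → ℝ}

theorem gradient_quadratic_apply {L : EuclideanSpace ℝ (Fin d) → ℝ}
    (hL : ∀ θ : EuclideanSpace ℝ (Fin d), L θ = (1 / 2) * ∑ k, lam k * (θ k - ϑ k) ^ 2)
    (θ : EuclideanSpace ℝ (Fin d)) (i : Fin d) :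
    gradient L θ i = lam i * (θ i - ϑ i) := by
  have hg : HasGradientAt L (WithLp.toLp 2 fun k => lam k * (θ k - ϑ k)) θ := by
    rw [hasGradientAt_iff_hasFDerivAt]
    have hterm : ∀ k : Fin d, HasFDerivAt (fun y : EuclideanSpace ℝ (Fin d) => y k)
        (EuclideanSpace.proj k : EuclideanSpace ℝ (Fin d) →L[ℝ] ℝ) θ := fun k =>
      (EuclideanSpace.proj k : EuclideanSpace ℝ (Fin d) →L[ℝ] ℝ).hasFDerivAt
    have hsum := (HasFDerivAt.fun_sum (u := Finset.univ) fun k _ =>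
      (((hterm k).sub_const (ϑ k)).pow 2).const_mul (lam k)).const_mul (1 / 2 : ℝ)
    rw [show L = fun θ => (1 / 2) * ∑ k, lam k * (θ k - ϑ k) ^ 2 from funext hL]
    refine hsum.congr_fderiv ?_
    ext y
    simp [PiLp.inner_apply, Finset.mul_sum]
    refine Finset.sum_congr rfl fun k _ => ?_
    ring
  rw [hg.gradient]

theorem gd_quadratic_apply {L : EuclideanSpace ℝ (Fin d) → ℝ}
    (hL : ∀ θ : EuclideanSpace ℝ (Fin d), L θ = (1 / 2) * ∑ k, lam k * (θ k - ϑ k) ^ 2)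
    {γ : ℝ} {ξ : EuclideanSpace ℝ (Fin d)} {Φ : ℕ → EuclideanSpace ℝ (Fin d)}
    (hΦ : IsGDTrajectory L γ ξ Φ) (i : Fin d) (n : ℕ) :
    Φ n i - ϑ i = (1 - γ * lam i) ^ n * (ξ i - ϑ i) := by
  induction n with
  | zero => simp [hΦ.init]
  | succ n ih =>
    rw [hΦ.step, PiLp.sub_apply, PiLp.smul_apply, gradient_quadratic_apply hL, smul_eq_mul, pow_succ]
    linear_combination (1 - γ * lam i) * ih

theorem adam_quadratic_isBigO {L : EuclideanSpace ℝ (Fin d) → ℝ}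
    (hL : ∀ θ : EuclideanSpace ℝ (Fin d), L θ = (1 / 2) * ∑ k, lam k * (θ k - ϑ k) ^ 2)
    {α β γ ε ρ : ℝ} (hρ : ρ ∈ Set.Ioo (0 : ℝ) 1) (hα : α = ρ ^ 2)
    (hβ : β ∈ Set.Ioo (α ^ 2) 1) (hγ : 0 < γ) (hε : 0 < ε) (hlam : ∀ i, 0 < lam i)
    (hlγ : ∀ i, lam i * γ < 1 / 2)
    (hp : ∀ i, (1 + α - (1 - α) * lam i * γ) ^ 2 ≤ 4 * ρ ^ 2)
    {ξ : EuclideanSpace ℝ (Fin d)} {Θ m M : ℕ → EuclideanSpace ℝ (Fin d)}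
    (hΘ : IsAdamTrajectory L α β (ε * γ) ε ξ Θ m M) {τ : ℝ} (hτ : 0 < τ) :
    (fun n => Θ n - ϑ) =O[atTop] fun n : ℕ => (ρ + τ) ^ n := by
  have hcoord : ∀ i, (fun n => (Θ n - ϑ) i) =O[atTop] fun n : ℕ => (ρ + τ) ^ n := fun i => by
    have hβ' : β ∈ Set.Ioo (0 : ℝ) 1 := ⟨(sq_nonneg α).trans_lt hβ.1, hβ.2⟩
    have hM : ∀ n, M (n + 1) i = β * M n i + (1 - β) * (lam i * (Θ n - ϑ) i) ^ 2 := fun n => by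
      rw [hΘ.step_M, gradient_quadratic_apply hL, PiLp.sub_apply]
    refine adam_coordinate_isBigO (m := fun n => m n i) (M := fun n => M n i) hρ hα hβ hγ hε
      (hlam i) (hlγ i) (hp i) (hΘ.init_nonneg i) (fun n => ?_) hM (fun n => ?_) hτ
    · rw [hΘ.step_m, gradient_quadratic_apply hL, PiLp.sub_apply]
    · rw [PiLp.sub_apply, PiLp.sub_apply, hΘ.step, adamStep, sqrt_div_eq_rpow_mul_rpow
        (secondMoment_nonneg (M := fun n => M n i) hβ' (hΘ.init_nonneg i) hM (n + 1))
        (one_sub_pow_succ_pos hβ' n)]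
      ring
  have hsum : (fun n => ∑ i, ‖(Θ n - ϑ) i‖) =O[atTop] fun n : ℕ => (ρ + τ) ^ n :=
    IsBigO.fun_sum fun i _ => (hcoord i).norm_left
  refine IsBigO.trans (IsBigO.of_norm_le fun n => ?_) hsum
  rw [EuclideanSpace.norm_eq]
  exact Real.sqrt_le_iff.2 ⟨by positivity, Finset.sum_sq_le_sq_sum_of_nonneg fun i _ => norm_nonneg _⟩

/-- The momentum parameter is so large that every eigenvalue is in the oscillating regime. -/
theorem momentum_discriminant_nonpos {ρ t a l : ℝ} (ht : t ∈ Set.Ioo (0 : ℝ) 1)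
    (hρ : ρ = (1 - t) / (1 + t)) (htl : t ≤ l) (hl : l ≤ 1) (ha : a = ρ ^ 2) :
    (1 + a - (1 - a) * l) ^ 2 ≤ 4 * ρ ^ 2 := by
  have h1 : 0 < 1 + t := by linarith [ht.1]
  have hρ0 : 0 < ρ := hρ ▸ div_pos (sub_pos.2 ht.2) h1
  -- Thus `t = (1 - ρ) / (1 + ρ)`: the discriminant vanishes exactly at `l = t`, the smallest
  -- eigenvalue.
  have ht' : t * (1 + ρ) = 1 - ρ := by rw [hρ]; field_simp; ring
  have hρ1 : 0 < 1 - ρ := ht' ▸ mul_pos ht.1 (by linarith)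
  have hlow : (1 - ρ) ^ 2 ≤ (1 - ρ ^ 2) * l := by
    calc (1 - ρ) ^ 2 = (1 - ρ) * (1 + ρ) * t := by linear_combination -(1 - ρ) * ht'
      _ ≤ (1 - ρ) * (1 + ρ) * l := by gcongr
      _ = _ := by ring
  have hup : (1 - ρ ^ 2) * l ≤ (1 + ρ) ^ 2 := by nlinarith
  rw [show 4 * ρ ^ 2 = (2 * ρ) ^ 2 by ring, ha]
  exact sq_le_sq' (by nlinarith) (by nlinarith)

end Quadratic

/-! ### Comparison of the two rates -/

theorem tendsto_zpow_neg_mul_norm_of_isBigO {E : Type*} [SeminormedAddCommGroup E] {f : ℕ → E}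
    {q r : ℝ} (hq : 0 ≤ q) (hqr : q < r) (h : f =O[atTop] fun n : ℕ => q ^ n) :
    Tendsto (fun n : ℕ => r ^ (-(n : ℤ)) * ‖f n‖) atTop (𝓝 0) := by
  have h1 := (h.trans_isLittleO (isLittleO_pow_pow_of_lt_left hq hqr)).norm_left.tendsto_div_nhds_zero
  refine h1.congr fun n => ?_
  rw [zpow_neg, zpow_natCast, inv_mul_eq_div]

theorem tendsto_zpow_neg_mul_atTop {f : ℕ → ℝ} {q r c : ℝ} (hr : 0 < r) (hrq : r < q) (hc : 0 < c)
    (h : ∀ n, q ^ n * c ≤ f n) :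
    Tendsto (fun n : ℕ => r ^ (-(n : ℤ)) * f n) atTop atTop := by
  refine tendsto_atTop_mono (fun n => ?_)
    ((tendsto_pow_atTop_atTop_of_one_lt ((one_lt_div hr).2 hrq)).atTop_mul_const hc)
  rw [zpow_neg, zpow_natCast, div_pow, div_eq_inv_mul, mul_assoc]
  gcongr
  exact h n

theorem theorem4p5 {d : ℕ} (ϑ ξ : EuclideanSpace ℝ (Fin d)) (lam : Fin d → ℝ) (κ K : ℝ)
    (hlam : ∀ i, 0 < lam i)
    (hξ : ∀ i, 0 < |ξ i - ϑ i|)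
    (hκ : IsLeast (Set.range lam) κ) (hK : IsGreatest (Set.range lam) K) (hκK : κ < K)
    (L : EuclideanSpace ℝ (Fin d) → ℝ)
    (hL : ∀ θ : EuclideanSpace ℝ (Fin d), L θ = (1 / 2) * ∑ k, lam k * (θ k - ϑ k) ^ 2)
    (ε : ℝ) (hε : ε ∈ Set.Ioo (0 : ℝ) 1)
    (γbar : ℝ) (hγbar : γbar ∈ Set.Ioo (0 : ℝ) (1 / (4 * K)))
    (α : ℝ) (hα : α = ((1 - γbar * κ) / (1 + γbar * κ)) ^ 2)
    (β : ℝ) (hβ : β ∈ Set.Ioo (α ^ 2) 1)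
    (γ : ℝ) (hγ : γ ∈ Set.Icc 0 γbar)
    (Φ : ℕ → EuclideanSpace ℝ (Fin d)) (hΦ : IsGDTrajectory L γ ξ Φ)
    (Θ m M : ℕ → EuclideanSpace ℝ (Fin d))
    (hΘ : IsAdamTrajectory L α β (ε * γbar) ε ξ Θ m M) :
    (∀ δ ∈ Set.Ioo (0 : ℝ) (1 - γbar * κ),
      Filter.Tendsto (fun n : ℕ => (1 - γbar * κ - δ) ^ (-(n : ℤ)) * ‖Φ n - ϑ‖)
          Filter.atTop Filter.atTop ∧
      Filter.Tendsto
          (fun n : ℕ => ((1 - γbar * κ) / (1 + γbar * κ) + δ) ^ (-(n : ℤ)) * ‖Θ n - ϑ‖)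
          Filter.atTop (nhds 0)) ∧
    (fun n : ℕ => Θ n - ϑ) =o[Filter.atTop] (fun n : ℕ => Φ n - ϑ) := by
  obtain ⟨hε0, -⟩ := hε
  obtain ⟨hγ0, hγ1⟩ := hγbar
  obtain ⟨i₀, hi₀⟩ := hκ.1
  have hκ0 : 0 < κ := hi₀ ▸ hlam i₀
  have hK0 : 0 < K := hκ0.trans hκK
  have hle : ∀ i, κ ≤ lam i := fun i => hκ.2 ⟨i, rfl⟩
  have hge : ∀ i, lam i ≤ K := fun i => hK.2 ⟨i, rfl⟩
  have hγK : γbar * K < 1 / 4 := by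
    rw [lt_div_iff₀ (by positivity)] at hγ1; linarith
  have hlγ : ∀ i, lam i * γbar < 1 / 4 := fun i => by nlinarith [hge i]
  have ht : γbar * κ ∈ Set.Ioo (0 : ℝ) (1 / 4) := ⟨by positivity, by nlinarith⟩
  set t := γbar * κ with htdef
  set ρ := (1 - t) / (1 + t) with hρdef
  have hρ0 : 0 < ρ := div_pos (by linarith [ht.2]) (by linarith [ht.1])
  have hρt : ρ < 1 - t := div_lt_self (by linarith [ht.2]) (by linarith [ht.1])
  have hp : ∀ i, (1 + α - (1 - α) * lam i * γbar) ^ 2 ≤ 4 * ρ ^ 2 := fun i => by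
    rw [mul_assoc]
    refine momentum_discriminant_nonpos ⟨ht.1, by linarith [ht.2]⟩ hρdef ?_
      (by linarith [hlγ i]) hα
    rw [htdef, mul_comm]
    exact mul_le_mul_of_nonneg_right (hle i) hγ0.le
  have hAdam : ∀ τ > 0, (fun n => Θ n - ϑ) =O[atTop] fun n : ℕ => (ρ + τ) ^ n := fun τ hτ =>
    adam_quadratic_isBigO hL ⟨hρ0, by linarith [ht.1]⟩ hα hβ hγ0 hε0 hlam
      (fun i => by linarith [hlγ i]) hp hΘ hτ
  have hGD : ∀ n, (1 - t) ^ n * |ξ i₀ - ϑ i₀| ≤ ‖Φ n - ϑ‖ := fun n => by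
    have h1 : 1 - t ≤ 1 - γ * lam i₀ := by
      rw [hi₀]; exact sub_le_sub_left (mul_le_mul_of_nonneg_right hγ.2 hκ0.le) 1
    have h2 : 0 ≤ 1 - t := by linarith [ht.2]
    calc (1 - t) ^ n * |ξ i₀ - ϑ i₀| ≤ (1 - γ * lam i₀) ^ n * |ξ i₀ - ϑ i₀| := by gcongr
      _ = ‖(Φ n - ϑ) i₀‖ := by
        rw [PiLp.sub_apply, gd_quadratic_apply hL hΦ, Real.norm_eq_abs, abs_mul, abs_pow,
          abs_of_nonneg (h2.trans h1)]
      _ ≤ _ := PiLp.norm_apply_le _ _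
  refine ⟨fun δ hδ => ⟨?_, ?_⟩, ?_⟩
  · exact tendsto_zpow_neg_mul_atTop (by linarith [hδ.2]) (by linarith [hδ.1]) (hξ i₀) hGD
  · exact tendsto_zpow_neg_mul_norm_of_isBigO (add_pos hρ0 (half_pos hδ.1)).le
      (by linarith [hδ.1]) (hAdam (δ / 2) (half_pos hδ.1))
  -- This `τ` puts Adam's rate midway between `ρ` and `1 - t`.
  · have hτ : 0 < (1 - t - ρ) / 2 := by linarith
    have hlt : ρ + (1 - t - ρ) / 2 < 1 - t := by linarith
    refine ((hAdam _ hτ).trans_isLittleO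
      (isLittleO_pow_pow_of_lt_left (by positivity) hlt)).trans_isBigO ?_
    refine IsBigO.of_bound |ξ i₀ - ϑ i₀|⁻¹ (Eventually.of_forall fun n => ?_)
    rw [inv_mul_eq_div, le_div_iff₀ (hξ i₀), norm_pow, Real.norm_of_nonneg (by linarith [ht.2])]
    exact hGD n
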